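/- All algebras are unital but not necessarily associative. For an $\mathbb{R}$-algebra $S$, the nucleus $N(S)$ is the set of $s\in S$ with $s(bc)=(sb)c$, $b(sc)=(bs)c$ and $b(cs)=(bc)s$ for all $b,c\in S$. The centralizer of $a\in S$ is $C_S(a)=\{b\in S: ab=ba\}$. A function $\chi:S\to\mathbb{Z}\cup\{-\infty\}$ is a pseudo-degree function if $\chi(a)=-\infty\iff a=0$, $\chi(ab)=\chi(a)+\chi(b)$ and $\chi(a+b)\le\max(\chi(a),\chi(b))$ for all $a,b\in S$. A subalgebra $B\subseteq S$ satisfies condition $D(\ell)$ with respect to $\chi$ if $\chi(b)\ge 0$ for every non-zero $b\in B$, and for all $b_1,\dots,b_{\ell+1}\in B$ with the same integer value of $\chi$ there are $\alpha_1,\dots,\alpha_{\ell+1}\in\mathbb{R}$, not all zero, with $\chi\bigl(\sum_i\alpha_i b_i\bigr)<\chi(b_1)$. **Theorem.** Let $\mathbb{O}$ be the real octonions, let $R=\mathbb{O}[y]$ be the ring of polynomials in a central indeterminate $y$, let $\delta=d/dy$ be the usual derivative on $R$, and let $T=R[x;\mathrm{id},\delta]$ be the non-associative Ore extension: the free left $R$-module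 with basis $1,x,x^2,\dots$ and with the biadditive multiplication given by $(bx^m)(cx^n)=\sum_{i=0}^m\binom{m}{i}\,b\,\delta^{m-i}(c)\,x^{i+n}$. Let $\chi$ be the degree with respect to $x$ (with $\chi(0)=-\infty$). Then: 1. $y\in N(T)$, and $\chi$ is a pseudo-degree function on $T$. 2. Let $a\in T$ have positive degree with respect to $x$ and have all its coefficients in $\mathbb{R}[y]$. Then $a\in N(T)$, the centralizer $C_T(a)$ satisfies condition $D(8)$ with respect to $\chi$, and $C_T(a)$ is a free left $\mathbb{R}[a]$-module of finite rank, where $\mathbb{R}[a]$ is the unital algebra generated by $a$, acting by multiplication in $T$. -/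

import Mathlib

open scoped Quaternion

noncomputable section

namespace NonAssocOre

/-! ## Non-associative algebras: nucleus, centralizer, degree functions -/

section Algebras

variable (K S : Type*) [Field K] [NonAssocRing S] [Module K S]
  [IsScalarTower K S S] [SMulCommClass K S S]

/-- The nucleus `N(S)`, the intersection of `N_l(S)`, `N_m(S)` and `N_r(S)`, of a unital, not
necessarily associative `K`-algebra `S`: the elements `a` such that `a(bc) = (ab)c`,
`b(ac) = (ba)c` and `b(ca) = (bc)a` for all `b, c`. -/
def nucleus : NonUnitalSubalgebra K S where
  carrier := {a | (∀ b c : S, a * (b * c) = (a * b) * c) ∧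
    (∀ b c : S, b * (a * c) = (b * a) * c) ∧ (∀ b c : S, b * (c * a) = (b * c) * a)}
  zero_mem' := by simp
  add_mem' := by
    rintro a a' ⟨h1, h2, h3⟩ ⟨h1', h2', h3'⟩
    refine ⟨fun b c => ?_, fun b c => ?_, fun b c => ?_⟩
    · rw [add_mul, add_mul, add_mul, h1, h1']
    · rw [add_mul, mul_add, mul_add, add_mul, h2, h2']
    · rw [mul_add, mul_add, mul_add, h3, h3']
  mul_mem' := by
    rintro a a' ⟨h1, h2, h3⟩ ⟨h1', h2', h3'⟩
    refine ⟨fun b c => ?_, fun b c => ?_, fun b c => ?_⟩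
    · rw [← h1, h1', h1, h1]
    · rw [← h1, h2, h2', h2]
    · rw [h3', h3', h3, h3']
  smul_mem' := by
    rintro k a ⟨h1, h2, h3⟩
    refine ⟨fun b c => ?_, fun b c => ?_, fun b c => ?_⟩
    · rw [smul_mul_assoc, smul_mul_assoc, smul_mul_assoc, h1]
    · rw [smul_mul_assoc, mul_smul_comm, mul_smul_comm, smul_mul_assoc, h2]
    · rw [mul_smul_comm, mul_smul_comm, mul_smul_comm, h3]

/-- The nucleus is an associative unital ring. -/
instance nucleusRing : Ring (nucleus K S) :=
  { (inferInstance : NonUnitalNonAssocRing (nucleus K S)) with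
    one := ⟨1, by simp, by simp, by simp⟩
    one_mul := fun a => Subtype.ext (one_mul (a : S))
    mul_one := fun a => Subtype.ext (mul_one (a : S))
    mul_assoc := fun a b c => Subtype.ext (a.2.1 (b : S) (c : S)).symm }

/-- The nucleus is an associative unital `K`-algebra. -/
instance nucleusAlgebra : Algebra K (nucleus K S) :=
  Algebra.ofModule (fun k a b => Subtype.ext (smul_mul_assoc k (a : S) (b : S)))
    (fun k a b => Subtype.ext (mul_smul_comm k (a : S) (b : S)))

/-- `S` is a left module over its nucleus, by left multiplication in `S`. -/
instance nucleusModule : Module (nucleus K S) S where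
  smul s c := (s : S) * c
  one_smul c := one_mul c
  mul_smul s t c := (s.2.1 (t : S) c).symm
  smul_zero s := mul_zero (s : S)
  smul_add s c d := mul_add (s : S) c d
  add_smul s t c := add_mul (s : S) (t : S) c
  zero_smul c := zero_mul c

variable {S}

/-- `K[a]`, the unital algebra generated by an element `a` of the nucleus. All its elements lie
in the nucleus. -/
abbrev algebraGenerated (a : S) (ha : a ∈ nucleus K S) : Subalgebra K (nucleus K S) :=
  Algebra.adjoin K {(⟨a, ha⟩ : nucleus K S)}

theorem mul_comm_of_mem_algebraGenerated {a : S} {ha : a ∈ nucleus K S} {r : nucleus K S}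
    (hr : r ∈ algebraGenerated K a ha) : a * (r : S) = (r : S) * a := by
  have h : (⟨a, ha⟩ : nucleus K S) * r = r * ⟨a, ha⟩ := by
    have hle : algebraGenerated K a ha ≤
        Subalgebra.centralizer K {(⟨a, ha⟩ : nucleus K S)} :=
      Algebra.adjoin_le (by
        rintro x rfl
        rw [SetLike.mem_coe, Subalgebra.mem_centralizer_iff]
        rintro g rfl
        rfl)
    exact (Subalgebra.mem_centralizer_iff K).1 (hle hr) _ rfl
  exact congrArg Subtype.val h

/-- The centralizer `C_S(a)` of an element `a` of the nucleus, with its structure of left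
`K[a]`-module, given by multiplication in `S`. -/
def centralizerModule (a : S) (ha : a ∈ nucleus K S) :
    Submodule (algebraGenerated K a ha) S where
  carrier := Set.centralizer {a}
  zero_mem' := by simp [Set.mem_centralizer_iff]
  add_mem' := by
    intro b c hb hc
    simp only [Set.mem_centralizer_iff, Set.mem_singleton_iff, forall_eq] at hb hc ⊢
    rw [mul_add, add_mul, hb, hc]
  smul_mem' := by
    rintro ⟨r, hr⟩ b hb
    simp only [Set.mem_centralizer_iff, Set.mem_singleton_iff, forall_eq] at hb ⊢
    change a * ((r : S) * b) = ((r : S) * b) * a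
    rw [ha.1, mul_comm_of_mem_algebraGenerated K hr, ← r.2.1, hb, ← r.2.1]

/-- `χ : S → ℤ ∪ {-∞}` is a pseudo-degree function. -/
structure IsPseudoDegree (χ : S → WithBot ℤ) : Prop where
  eq_bot_iff : ∀ a, χ a = ⊥ ↔ a = 0
  map_mul : ∀ a b, χ (a * b) = χ a + χ b
  map_add_le : ∀ a b, χ (a + b) ≤ max (χ a) (χ b)

/-- Condition `D(ℓ)` on (the underlying set of) a subalgebra `B` of `S`, with respect to `χ`. -/
def ConditionD (χ : S → WithBot ℤ) (B : Set S) (ℓ : ℕ) : Prop :=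
  (∀ b ∈ B, b ≠ 0 → 0 ≤ χ b) ∧
  ∀ b : Fin (ℓ + 1) → S, (∀ i, b i ∈ B) → (∃ d : ℤ, ∀ i, χ (b i) = d) →
    ∃ α : Fin (ℓ + 1) → K, (∃ i, α i ≠ 0) ∧ χ (∑ i, α i • b i) < χ (b 0)

end Algebras

/-! ## Non-associative Ore extensions -/

/-- Data for a non-associative Ore extension of the `K`-algebra `R`: an algebra endomorphism `σ`
and a `K`-linear map `δ` with `δ(rs) = σ(r)δ(s) + δ(r)s`. -/
structure OreData (K R : Type*) [Field K] [NonAssocRing R] [Module K R] where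
  σ : R →ₗ[K] R
  δ : R →ₗ[K] R
  σ_one : σ 1 = 1
  σ_mul : ∀ r s, σ (r * s) = σ r * σ s
  δ_mul : ∀ r s, δ (r * s) = σ r * δ s + δ r * s

namespace OreData

variable {K R : Type*} [Field K] [NonAssocRing R] [Module K R] (D : OreData K R)

/-- `D.π m i` is the sum of all `m.choose i` compositions of `i` copies of `σ` and `m - i` copies
of `δ`, in any order. -/
def π : ℕ → ℕ → R →ₗ[K] R
  | 0, 0 => LinearMap.id
  | 0, _ + 1 => 0
  | m + 1, 0 => D.δ ∘ₗ π m 0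
  | m + 1, i + 1 => D.σ ∘ₗ π m i + D.δ ∘ₗ π m (i + 1)

theorem δ_one : D.δ 1 = 0 := by
  have h := D.δ_mul 1 1
  simpa [D.σ_one] using h

theorem π_one (m i : ℕ) : D.π m i 1 = if i = m then 1 else 0 := by
  induction m generalizing i with
  | zero => cases i <;> simp [π]
  | succ m ih =>
    cases i with
    | zero => simp only [π, LinearMap.comp_apply, ih]; split_ifs <;> simp_all [δ_one]
    | succ i =>
      simp only [π, LinearMap.add_apply, LinearMap.comp_apply, ih]
      split_ifs <;> simp_all [δ_one, σ_one]

end OreData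

/-- The non-associative Ore extension `R[x; σ, δ]`: the finite formal sums `∑ aₙ xⁿ` with
coefficients in `R`, written on the left of the powers of `x`. -/
def OreExtension {K R : Type*} [Field K] [NonAssocRing R] [Module K R] (_D : OreData K R) :
    Type _ :=
  ℕ →₀ R

namespace OreExtension

variable {K R : Type*} [Field K] [NonAssocRing R] [Module K R] {D : OreData K R}

instance : AddCommGroup (OreExtension D) := inferInstanceAs (AddCommGroup (ℕ →₀ R))

instance : Module K (OreExtension D) := inferInstanceAs (Module K (ℕ →₀ R))

/-- The coefficient of `xⁿ`. -/
def coeff (p : OreExtension D) (n : ℕ) : R := (show ℕ →₀ R from p) n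

/-- The element `a xⁿ`. -/
def monomial (n : ℕ) (a : R) : OreExtension D := Finsupp.single n a

/-- The degree with respect to `x`, with `degree 0 = -∞`. -/
def degree (p : OreExtension D) : WithBot ℤ :=
  WithBot.map (Nat.cast : ℕ → ℤ) (Finsupp.support (show ℕ →₀ R from p)).max

theorem monomial_add (n : ℕ) (a b : R) :
    (monomial n (a + b) : OreExtension D) = monomial n a + monomial n b :=
  Finsupp.single_add n a b

theorem monomial_zero (n : ℕ) : (monomial n 0 : OreExtension D) = 0 :=
  Finsupp.single_zero n

theorem smul_monomial (k : K) (n : ℕ) (a : R) :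
    k • (monomial n a : OreExtension D) = monomial n (k • a) :=
  Finsupp.smul_single k n a

/-- The product `(a x^m)(b x^n) = ∑ᵢ (a π_i^m(b)) x^(i+n)` of two monomials. -/
def monomialMul (m : ℕ) (a : R) (n : ℕ) (b : R) : OreExtension D :=
  ∑ i ∈ Finset.range (m + 1), monomial (i + n) (a * D.π m i b)

/-- The multiplication of `R[x; σ, δ]`, extended biadditively from monomials. -/
def mul (p q : OreExtension D) : OreExtension D :=
  Finsupp.sum (show ℕ →₀ R from p) fun m a =>
    Finsupp.sum (show ℕ →₀ R from q) fun n b => monomialMul m a n b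

instance : Mul (OreExtension D) := ⟨mul⟩

instance : One (OreExtension D) := ⟨monomial 0 1⟩

theorem monomialMul_add_left (m : ℕ) (a a' : R) (n : ℕ) (b : R) :
    (monomialMul m (a + a') n b : OreExtension D) =
      monomialMul m a n b + monomialMul m a' n b := by
  simp [monomialMul, add_mul, monomial_add, Finset.sum_add_distrib]

theorem monomialMul_add_right (m : ℕ) (a : R) (n : ℕ) (b b' : R) :
    (monomialMul m a n (b + b') : OreExtension D) =
      monomialMul m a n b + monomialMul m a n b' := by
  simp [monomialMul, mul_add, monomial_add, Finset.sum_add_distrib]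

theorem monomialMul_zero_left (m n : ℕ) (b : R) :
    (monomialMul m 0 n b : OreExtension D) = 0 := by
  simp [monomialMul, monomial_zero]

theorem monomialMul_zero_right (m : ℕ) (a : R) (n : ℕ) :
    (monomialMul m a n 0 : OreExtension D) = 0 := by
  simp [monomialMul, monomial_zero]

protected theorem add_mul' (p p' q : OreExtension D) : (p + p') * q = p * q + p' * q := by
  change mul (p + p') q = mul p q + mul p' q
  unfold mul
  refine Finsupp.sum_add_index' (M := R) (N := OreExtension D) (f := p) (g := p')
    (fun m => ?_) (fun m a a' => ?_)
  · simp only [monomialMul_zero_left]; exact Finset.sum_const_zero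
  · simp only [monomialMul_add_left]; exact Finsupp.sum_add

protected theorem mul_add' (p q q' : OreExtension D) : p * (q + q') = p * q + p * q' := by
  change mul p (q + q') = mul p q + mul p q'
  unfold mul
  refine Eq.trans ?_ Finsupp.sum_add
  refine Finsupp.sum_congr fun m _ => ?_
  exact Finsupp.sum_add_index' (f := q) (g := q') (fun n => monomialMul_zero_right ..)
    (fun n b b' => monomialMul_add_right ..)

theorem monomial_mul_monomial (m : ℕ) (a : R) (n : ℕ) (b : R) :
    (monomial m a * monomial n b : OreExtension D) = monomialMul m a n b := by
  change mul _ _ = _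
  unfold mul monomial
  rw [Finsupp.sum_single_index, Finsupp.sum_single_index]
  · exact monomialMul_zero_right ..
  · simp only [monomialMul_zero_left]; exact Finset.sum_const_zero

@[elab_as_elim]
theorem induction {P : OreExtension D → Prop} (p : OreExtension D) (h0 : P 0)
    (ha : ∀ p q, P p → P q → P (p + q)) (hm : ∀ n a, P (monomial n a)) : P p :=
  Finsupp.induction_linear (motive := P) p h0 ha hm

protected theorem zero_mul' (q : OreExtension D) : 0 * q = 0 := by
  have h := OreExtension.add_mul' 0 0 q
  simpa using h

protected theorem mul_zero' (p : OreExtension D) : p * 0 = 0 := by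
  have h := OreExtension.mul_add' p 0 0
  simpa using h

instance : NonAssocRing (OreExtension D) :=
  { (inferInstance : AddCommGroup (OreExtension D)) with
    left_distrib := OreExtension.mul_add'
    right_distrib := OreExtension.add_mul'
    zero_mul := OreExtension.zero_mul'
    mul_zero := OreExtension.mul_zero'
    one_mul := fun p => by
      induction p using OreExtension.induction with
      | h0 => exact OreExtension.mul_zero' _
      | ha p q hp hq => rw [OreExtension.mul_add', hp, hq]
      | hm n a =>
        change monomial 0 1 * monomial n a = _
        rw [monomial_mul_monomial]
        simp [monomialMul, OreData.π]
    mul_one := fun p => by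
      induction p using OreExtension.induction with
      | h0 => exact OreExtension.zero_mul' _
      | ha p q hp hq => rw [OreExtension.add_mul', hp, hq]
      | hm n a =>
        change monomial n a * monomial 0 1 = _
        rw [monomial_mul_monomial, monomialMul, Finset.sum_eq_single n]
        · simp [OreData.π_one]
        · intro i _ hi
          simp [OreData.π_one, hi, monomial_zero]
        · simp }

section Scalars

variable [IsScalarTower K R R]

instance : IsScalarTower K (OreExtension D) (OreExtension D) where
  smul_assoc k p q := by
    simp only [smul_eq_mul]
    induction p using OreExtension.induction with
    | h0 => simp
    | ha p p' hp hp' => rw [smul_add, add_mul, add_mul, smul_add, hp, hp']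
    | hm m a =>
      induction q using OreExtension.induction with
      | h0 => simp
      | ha q q' hq hq' => rw [mul_add, mul_add, smul_add, hq, hq']
      | hm n b =>
        simp [smul_monomial, monomial_mul_monomial, monomialMul, Finset.smul_sum, smul_mul_assoc]

instance [SMulCommClass K R R] : SMulCommClass K (OreExtension D) (OreExtension D) where
  smul_comm k p q := by
    simp only [smul_eq_mul]
    induction p using OreExtension.induction with
    | h0 => simp
    | ha p p' hp hp' => rw [add_mul, add_mul, smul_add, hp, hp']
    | hm m a =>
      induction q using OreExtension.induction with
      | h0 => simp
      | ha q q' hq hq' => rw [mul_add, smul_add, smul_add, mul_add, hq, hq']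
      | hm n b =>
        simp [smul_monomial, monomial_mul_monomial, monomialMul, Finset.smul_sum, mul_smul_comm]

end Scalars

end OreExtension

/-! ## Polynomials in a central indeterminate over a non-associative algebra -/

section Polynomials

variable (K A : Type*) [Field K] [NonAssocRing A] [Module K A]

/-- The data `σ = id`, `δ = 0`. -/
def polyData : OreData K A where
  σ := LinearMap.id
  δ := 0
  σ_one := rfl
  σ_mul _ _ := rfl
  δ_mul _ _ := by simp

/-- The ring `A[y]` of polynomials in a central indeterminate `y`, which is `A[y; id, 0]`. -/
abbrev Poly : Type _ := OreExtension (polyData K A)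

variable {K A}

theorem polyData_π (m i : ℕ) (a : A) : (polyData K A).π m i a = if i = m then a else 0 := by
  induction m generalizing i with
  | zero => cases i <;> simp [OreData.π]
  | succ m ih =>
    have hσ : (polyData K A).σ = LinearMap.id := rfl
    have hδ : (polyData K A).δ = 0 := rfl
    cases i <;> simp [OreData.π, ih, hσ, hδ]

theorem Poly.monomial_mul_monomial (m n : ℕ) (a b : A) :
    (OreExtension.monomial m a * OreExtension.monomial n b : Poly K A) =
      OreExtension.monomial (m + n) (a * b) := by
  rw [OreExtension.monomial_mul_monomial, OreExtension.monomialMul, Finset.sum_eq_single m]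
  · simp [polyData_π]
  · intro i _ hi
    simp [polyData_π, hi, OreExtension.monomial_zero]
  · simp

/-- The usual derivative `∑ bₙ yⁿ ↦ ∑ n bₙ yⁿ⁻¹` on `A[y]`. -/
def Poly.derivative : Poly K A →ₗ[K] Poly K A :=
  Finsupp.lsum K (M := A) fun n => (n : K) • (Finsupp.lsingle (n - 1) : A →ₗ[K] (ℕ →₀ A))

theorem Poly.derivative_monomial (n : ℕ) (a : A) :
    Poly.derivative (OreExtension.monomial n a : Poly K A) =
      OreExtension.monomial (n - 1) ((n : K) • a) := by
  refine (Finsupp.lsum_single (S := K) _ _ _).trans ?_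
  exact OreExtension.smul_monomial (D := polyData K A) _ _ _

theorem Poly.derivative_mul [IsScalarTower K A A] [SMulCommClass K A A] (p q : Poly K A) :
    Poly.derivative (p * q) = p * Poly.derivative q + Poly.derivative p * q := by
  induction p using OreExtension.induction with
  | h0 => simp
  | ha p p' hp hp' => rw [add_mul, map_add, map_add, hp, hp', add_mul, add_mul]; abel
  | hm m a =>
    induction q using OreExtension.induction with
    | h0 => simp
    | ha q q' hq hq' => rw [mul_add, map_add, map_add, hq, hq', mul_add, mul_add]; abel
    | hm n b =>
      simp only [Poly.monomial_mul_monomial, Poly.derivative_monomial]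
      rcases Nat.eq_zero_or_pos m with rfl | hm
      · simp [OreExtension.monomial_zero, mul_smul_comm]
      · rcases Nat.eq_zero_or_pos n with rfl | hn
        · simp [OreExtension.monomial_zero, smul_mul_assoc]
        · rw [show m + (n - 1) = m + n - 1 by omega, show m - 1 + n = m + n - 1 by omega,
            ← OreExtension.monomial_add, mul_smul_comm, smul_mul_assoc, ← add_smul]
          congr 2
          push_cast
          ring

/-- The data `σ = id`, `δ = d/dy` on `A[y]`. -/
def diffData (K A : Type*) [Field K] [NonAssocRing A] [Module K A]
    [IsScalarTower K A A] [SMulCommClass K A A] : OreData K (Poly K A) where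
  σ := LinearMap.id
  δ := Poly.derivative
  σ_one := rfl
  σ_mul _ _ := rfl
  δ_mul := Poly.derivative_mul

end Polynomials

/-! ## The octonions -/

/-- The real octonions, obtained from Hamilton's quaternions by the Cayley–Dickson
construction. -/
def Octonion : Type := ℍ[ℝ] × ℍ[ℝ]

namespace Octonion

instance : AddCommGroup Octonion := inferInstanceAs (AddCommGroup (ℍ[ℝ] × ℍ[ℝ]))

instance : Module ℝ Octonion := inferInstanceAs (Module ℝ (ℍ[ℝ] × ℍ[ℝ]))

/-- `(a, b)(c, d) = (ac - d̄b, da + bc̄)`. -/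
instance : Mul Octonion :=
  ⟨fun u v => (u.1 * v.1 - star v.2 * u.2, v.2 * u.1 + u.2 * star v.1)⟩

instance : One Octonion := ⟨((1 : ℍ[ℝ]), (0 : ℍ[ℝ]))⟩

protected theorem ext {u v : Octonion} (h1 : u.1 = v.1) (h2 : u.2 = v.2) : u = v :=
  Prod.ext h1 h2

theorem mul_fst (u v : Octonion) : (u * v).1 = u.1 * v.1 - star v.2 * u.2 := rfl
theorem mul_snd (u v : Octonion) : (u * v).2 = v.2 * u.1 + u.2 * star v.1 := rfl
theorem one_fst : (1 : Octonion).1 = 1 := rfl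
theorem one_snd : (1 : Octonion).2 = 0 := rfl
theorem zero_fst : (0 : Octonion).1 = 0 := rfl
theorem zero_snd : (0 : Octonion).2 = 0 := rfl
theorem add_fst (u v : Octonion) : (u + v).1 = u.1 + v.1 := rfl
theorem add_snd (u v : Octonion) : (u + v).2 = u.2 + v.2 := rfl
theorem smul_fst (k : ℝ) (u : Octonion) : (k • u).1 = k • u.1 := rfl
theorem smul_snd (k : ℝ) (u : Octonion) : (k • u).2 = k • u.2 := rfl

instance : NonAssocRing Octonion :=
  { (inferInstance : AddCommGroup Octonion) with
    left_distrib := fun u v w => by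
      apply Octonion.ext <;>
        simp only [mul_fst, mul_snd, add_fst, add_snd, star_add, mul_add, add_mul] <;> abel
    right_distrib := fun u v w => by
      apply Octonion.ext <;>
        simp only [mul_fst, mul_snd, add_fst, add_snd, mul_add, add_mul] <;> abel
    zero_mul := fun u => by
      apply Octonion.ext <;> simp [mul_fst, mul_snd, zero_fst, zero_snd]
    mul_zero := fun u => by
      apply Octonion.ext <;> simp [mul_fst, mul_snd, zero_fst, zero_snd]
    one_mul := fun u => by
      apply Octonion.ext <;> simp [mul_fst, mul_snd, one_fst, one_snd]
    mul_one := fun u => by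
      apply Octonion.ext <;> simp [mul_fst, mul_snd, one_fst, one_snd] }

instance : IsScalarTower ℝ Octonion Octonion where
  smul_assoc k u v := by
    apply Octonion.ext <;>
      simp [smul_eq_mul, mul_fst, mul_snd, smul_fst, smul_snd, smul_sub, smul_add]

instance : SMulCommClass ℝ Octonion Octonion where
  smul_comm k u v := by
    apply Octonion.ext <;>
      simp [smul_eq_mul, mul_fst, mul_snd, smul_fst, smul_snd, smul_sub, smul_add]

end Octonion

/-! ## The octonionic differential operator ring -/

/-- `T = 𝕆[y][x; id, d/dy]`. -/
abbrev OctDiffRing : Type := OreExtension (diffData ℝ Octonion)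

/-- The element `y` of `𝕆[y]`. -/
def polyY : Poly ℝ Octonion := OreExtension.monomial 1 1

/-- The element `y` of `T`. -/
def octY : OctDiffRing := OreExtension.monomial 0 polyY

/-- All coefficients of `a ∈ T` with respect to `x` belong to `ℝ[y]`, that is, they are
polynomials in `y` whose coefficients are real multiples of `1 ∈ 𝕆`. -/
def HasRealPolyCoeffs (a : OctDiffRing) : Prop :=
  ∀ n i : ℕ, ∃ r : ℝ, (a.coeff n).coeff i = r • (1 : Octonion)

end NonAssocOre

end

open scoped Quaternion


namespace NonAssocOre

namespace OreExtension

variable {K R : Type*} [Field K] [NonAssocRing R] [Module K R] {D : OreData K R}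

/-! Since `σ = id`, the top coefficient in `x` of a product is the product of the top coefficients.
The octonions have no zero divisors, so neither do `𝕆[y]` and `T`, and the degree is a pseudo-degree
function. A check on monomials puts `x` in the nucleus; the relation `xy = yx + 1` then puts `y`
there, and hence every real polynomial expression in `y` and `x`.

Let `a` have degree `n` and top coefficient `p` of degree `e` in `y`, and let `b` of degree `m` and
top coefficient `q` commute with `a`. The coefficients of `a` are central in `𝕆[y]`, so the
coefficient of `x^(m+n-1)` in `ab - ba` is just `n p q' - m q p'` (`coeff_mul_sub_mul`). Its
vanishing forces `n deg q = m e` (`natDegree_relation`). Thus `m` determines `deg q`, and one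
octonion, the leading symbol, detects whether `q` vanishes (`coeff_eq_zero_of_leadSymbol`). Nine
symbols in an 8-dimensional space are dependent, which is `D(8)`.

Multiplication by `a` rescales symbols by a non-zero real, so the symbol spaces ascend along each
residue class mod `n` and stabilise. In high degree, top terms can then be removed by multiples of
`a`, which gives finite generation over `ℝ[a]`. Finally, `ℝ[a]` is a principal ideal domain and the
centralizer is torsion-free over it, hence free. -/

/-! ### Coefficients and degree in `x` -/

@[ext]
theorem ext_coeff {p q : OreExtension D} (h : ∀ n, p.coeff n = q.coeff n) : p = q :=
  Finsupp.ext (α := ℕ) (M := R) h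

theorem coeff_add (p q : OreExtension D) (n : ℕ) : (p + q).coeff n = p.coeff n + q.coeff n :=
  rfl

theorem coeff_zero (n : ℕ) : (0 : OreExtension D).coeff n = 0 :=
  rfl

theorem coeff_smul (k : K) (p : OreExtension D) (n : ℕ) : (k • p).coeff n = k • p.coeff n :=
  rfl

variable (D) in
/-- Taking the coefficient of `xⁿ`, as a linear map. -/
noncomputable def lcoeff (n : ℕ) : OreExtension D →ₗ[K] R where
  toFun p := p.coeff n
  map_add' _ _ := rfl
  map_smul' _ _ := rfl

theorem lcoeff_apply (n : ℕ) (p : OreExtension D) : lcoeff D n p = p.coeff n :=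
  rfl

theorem coeff_sum {ι : Type*} (s : Finset ι) (f : ι → OreExtension D) (n : ℕ) :
    (∑ i ∈ s, f i).coeff n = ∑ i ∈ s, (f i).coeff n :=
  map_sum (lcoeff D n) f s

theorem coeff_monomial (m n : ℕ) (a : R) :
    (monomial m a : OreExtension D).coeff n = if m = n then a else 0 :=
  Finsupp.single_apply

/-- The exponents of the powers of `x` that occur in `p`. -/
noncomputable def support (p : OreExtension D) : Finset ℕ :=
  Finsupp.support (show ℕ →₀ R from p)

theorem mem_support {p : OreExtension D} {n : ℕ} : n ∈ p.support ↔ p.coeff n ≠ 0 :=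
  Finsupp.mem_support_iff

theorem sum_monomial (p : OreExtension D) : ∑ n ∈ p.support, monomial n (p.coeff n) = p :=
  Finsupp.sum_single (show ℕ →₀ R from p)

theorem degree_zero : (0 : OreExtension D).degree = ⊥ :=
  rfl

theorem degree_eq_natCast {p : OreExtension D} {m : ℕ} (h : p.coeff m ≠ 0)
    (h' : ∀ k, m < k → p.coeff k = 0) : p.degree = ((m : ℤ) : WithBot ℤ) := by
  have : p.support.max = (m : WithBot ℕ) := by
    refine le_antisymm (Finset.max_le fun k hk => ?_) (Finset.le_max (mem_support.2 h))
    by_contra hlt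
    exact mem_support.1 hk (h' k (WithBot.coe_lt_coe.1 (not_le.1 hlt)))
  change WithBot.map _ p.support.max = _
  rw [this]
  rfl

theorem exists_degree_eq {p : OreExtension D} (hp : p ≠ 0) :
    ∃ m : ℕ, p.degree = ((m : ℤ) : WithBot ℤ) ∧ p.coeff m ≠ 0 ∧ ∀ k, m < k → p.coeff k = 0 := by
  have hne : p.support.Nonempty := by
    by_contra h
    refine hp (ext_coeff fun n => ?_)
    by_contra hn
    exact h ⟨n, mem_support.2 hn⟩
  have h1 : p.coeff (p.support.max' hne) ≠ 0 := mem_support.1 (Finset.max'_mem _ _)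
  have h2 : ∀ k, p.support.max' hne < k → p.coeff k = 0 := fun k hk => by
    by_contra h
    exact absurd (Finset.le_max' _ _ (mem_support.2 h)) (not_le.2 hk)
  exact ⟨_, degree_eq_natCast h1 h2, h1, h2⟩

theorem degree_eq_bot_iff {p : OreExtension D} : p.degree = ⊥ ↔ p = 0 := by
  refine ⟨fun h => ?_, fun h => h ▸ degree_zero⟩
  by_contra hp
  obtain ⟨m, hm, -⟩ := exists_degree_eq hp
  rw [hm] at h
  exact WithBot.coe_ne_bot h

theorem coeff_ne_zero_of_degree_eq {p : OreExtension D} {m : ℕ}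
    (h : p.degree = ((m : ℤ) : WithBot ℤ)) :
    p.coeff m ≠ 0 ∧ ∀ k, m < k → p.coeff k = 0 := by
  have hp : p ≠ 0 := by
    rintro rfl
    rw [degree_zero] at h
    exact WithBot.bot_ne_coe h
  obtain ⟨m', h1, h2⟩ := exists_degree_eq hp
  obtain rfl : m' = m := by rw [h1] at h; exact_mod_cast h
  exact h2

theorem degree_lt_of_coeff_eq_zero {p : OreExtension D} {m : ℕ}
    (h : ∀ k, m ≤ k → p.coeff k = 0) : p.degree < ((m : ℤ) : WithBot ℤ) := by
  by_cases hp : p = 0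
  · rw [hp, degree_zero]
    exact WithBot.bot_lt_coe _
  · obtain ⟨m', h1, h2, -⟩ := exists_degree_eq hp
    have : m' < m := by
      by_contra hle
      exact h2 (h m' (not_lt.1 hle))
    rw [h1]
    exact_mod_cast this

theorem degree_add_le (p q : OreExtension D) : (p + q).degree ≤ max p.degree q.degree := by
  by_cases hp : p = 0
  · simp [hp]
  by_cases hq : q = 0
  · simp [hq]
  by_cases hpq : p + q = 0
  · rw [hpq, degree_zero]
    exact bot_le
  obtain ⟨m, h1, -, h2⟩ := exists_degree_eq hp
  obtain ⟨n, h3, -, h4⟩ := exists_degree_eq hq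
  obtain ⟨k, h5, h6, -⟩ := exists_degree_eq hpq
  have : k ≤ max m n := by
    by_contra hlt
    rw [not_le, max_lt_iff] at hlt
    exact h6 (by rw [coeff_add, h2 k hlt.1, h4 k hlt.2, add_zero])
  rw [h1, h3, h5]
  rw [le_max_iff] at this ⊢
  exact_mod_cast this

/-! ### The operators `π` and the coefficients of products -/

theorem π_eq_zero {m i : ℕ} (h : m < i) : D.π m i = 0 := by
  induction m generalizing i with
  | zero => obtain ⟨i, rfl⟩ := Nat.exists_eq_succ_of_ne_zero h.ne'; rfl
  | succ m ih =>
    obtain ⟨i, rfl⟩ := Nat.exists_eq_succ_of_ne_zero (by omega : i ≠ 0)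
    simp only [OreData.π]
    rw [ih (by omega), ih (by omega), LinearMap.comp_zero, LinearMap.comp_zero, add_zero]

theorem π_self (hσ : D.σ = LinearMap.id) (m : ℕ) : D.π m m = LinearMap.id := by
  induction m with
  | zero => rfl
  | succ m ih =>
    simp only [OreData.π]
    rw [ih, π_eq_zero (Nat.lt_succ_self m), hσ, LinearMap.comp_zero, add_zero, LinearMap.comp_id]

theorem π_succ_self (hσ : D.σ = LinearMap.id) (m : ℕ) (r : R) :
    D.π (m + 1) m r = (m + 1) • D.δ r := by
  induction m with
  | zero => simp [OreData.π]
  | succ m ih =>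
    rw [OreData.π, LinearMap.add_apply, LinearMap.comp_apply, LinearMap.comp_apply, ih,
      π_self hσ, hσ, LinearMap.id_apply, LinearMap.id_apply, succ_nsmul _ (m + 1)]

theorem δ_π (hσ : D.σ = LinearMap.id) (m i : ℕ) (r : R) :
    D.δ (D.π m i r) = D.π m i (D.δ r) := by
  induction m generalizing i with
  | zero => cases i <;> simp [OreData.π]
  | succ m ih => cases i <;> simp [OreData.π, ih, hσ]

theorem coeff_monomial_mul_monomial (m n k : ℕ) (a b : R) :
    (monomial m a * monomial n b : OreExtension D).coeff k =
      if n ≤ k then a * D.π m (k - n) b else 0 := by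
  rw [monomial_mul_monomial, monomialMul, coeff_sum]
  simp only [coeff_monomial]
  split_ifs with h
  · rw [Finset.sum_eq_single (k - n), if_pos (by omega)]
    · intro i _ hi
      rw [if_neg (by omega)]
    · intro hi
      rw [Finset.mem_range] at hi
      rw [π_eq_zero (by omega)]
      simp
  · exact Finset.sum_eq_zero fun i _ => if_neg (by omega)

theorem coeff_mul (p q : OreExtension D) (k : ℕ) :
    (p * q).coeff k = ∑ s ∈ p.support, ∑ t ∈ q.support,
      if t ≤ k then p.coeff s * D.π s (k - t) (q.coeff t) else 0 := by
  conv_lhs => rw [← sum_monomial p, ← sum_monomial q, Finset.sum_mul, coeff_sum]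
  simp only [Finset.mul_sum, coeff_sum, coeff_monomial_mul_monomial]

theorem coeff_mul_of_lt {p q : OreExtension D} {m n k : ℕ} (hp : ∀ s, m < s → p.coeff s = 0)
    (hq : ∀ t, n < t → q.coeff t = 0) (hk : m + n < k) : (p * q).coeff k = 0 := by
  rw [coeff_mul]
  refine Finset.sum_eq_zero fun s hs => Finset.sum_eq_zero fun t ht => ?_
  have h1 : s ≤ m := by
    by_contra h
    exact mem_support.1 hs (hp s (by omega))
  have h2 : t ≤ n := by
    by_contra h
    exact mem_support.1 ht (hq t (by omega))
  rw [π_eq_zero (by omega)]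
  simp

/-- Any pair of exponents other than `(m, n)` has too small a sum to reach `m + n`. Only upper
bounds are assumed, so the top coefficients may vanish. -/
theorem coeff_mul_add (hσ : D.σ = LinearMap.id) {p q : OreExtension D} {m n : ℕ}
    (hp : ∀ s, m < s → p.coeff s = 0) (hq : ∀ t, n < t → q.coeff t = 0) :
    (p * q).coeff (m + n) = p.coeff m * q.coeff n := by
  rw [coeff_mul, Finset.sum_eq_single m]
  · rw [Finset.sum_eq_single n]
    · rw [if_pos (by omega), Nat.add_sub_cancel, π_self hσ, LinearMap.id_apply]
    · intro t ht htn
      have h2 : t ≤ n := by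
        by_contra h
        exact mem_support.1 ht (hq t (by omega))
      rw [π_eq_zero (by omega)]
      simp
    · intro h
      rw [mem_support, not_not] at h
      simp [h]
  · intro s hs hsm
    have h1 : s ≤ m := by
      by_contra h
      exact mem_support.1 hs (hp s (by omega))
    refine Finset.sum_eq_zero fun t ht => ?_
    have h2 : t ≤ n := by
      by_contra h
      exact mem_support.1 ht (hq t (by omega))
    rw [π_eq_zero (by omega)]
    simp
  · intro h
    rw [mem_support, not_not] at h
    simp [h]

theorem isPseudoDegree_degree (hσ : D.σ = LinearMap.id) [NoZeroDivisors R] :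
    IsPseudoDegree (degree : OreExtension D → WithBot ℤ) where
  eq_bot_iff _ := degree_eq_bot_iff
  map_add_le := degree_add_le
  map_mul p q := by
    by_cases hp : p = 0
    · simp [hp, degree_zero]
    by_cases hq : q = 0
    · simp [hq, degree_zero]
    obtain ⟨m, h1, h2, h3⟩ := exists_degree_eq hp
    obtain ⟨n, h4, h5, h6⟩ := exists_degree_eq hq
    rw [h1, h4, degree_eq_natCast (m := m + n)]
    · push_cast
      rfl
    · rw [coeff_mul_add hσ h3 h6]
      exact mul_ne_zero h2 h5
    · exact fun k hk => coeff_mul_of_lt h3 h6 hk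

/-- Used twice: to pass from `𝕆` to `𝕆[y]`, and from `𝕆[y]` to `T`. -/
theorem noZeroDivisors (hσ : D.σ = LinearMap.id) [NoZeroDivisors R] :
    NoZeroDivisors (OreExtension D) where
  eq_zero_or_eq_zero_of_mul_eq_zero {p q} h := by
    have := (isPseudoDegree_degree hσ).map_mul p q
    rw [h, degree_zero, eq_comm, WithBot.add_eq_bot] at this
    simpa only [degree_eq_bot_iff] using this

/-- The coefficient of the highest power of `x` that may occur in a commutator with an element
whose coefficients are central. -/
theorem coeff_mul_sub_mul (hσ : D.σ = LinearMap.id) {p q : OreExtension D} {m n : ℕ}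
    (hp : ∀ s, m + 1 < s → p.coeff s = 0) (hq : ∀ t, n < t → q.coeff t = 0)
    (hc : ∀ s r, p.coeff s * r = r * p.coeff s) :
    (p * q).coeff (m + n) - (q * p).coeff (m + n) =
      (m + 1) • (p.coeff (m + 1) * D.δ (q.coeff n)) -
        n • (q.coeff n * D.δ (p.coeff (m + 1))) := by
  -- Away from the top pair, `s + t ≤ m + n`. On equality the contribution is a commutator with a
  -- central coefficient; otherwise both terms vanish.
  have key : ∀ s ∈ p.support, ∀ t ∈ q.support, (s ≠ m + 1 ∨ t ≠ n) →
      ((if t ≤ m + n then p.coeff s * D.π s (m + n - t) (q.coeff t) else 0) -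
        if s ≤ m + n then q.coeff t * D.π t (m + n - s) (p.coeff s) else 0) = 0 := by
    intro s hs t ht hst
    have h1 : s ≤ m + 1 := by
      by_contra h
      exact mem_support.1 hs (hp s (by omega))
    have h2 : t ≤ n := by
      by_contra h
      exact mem_support.1 ht (hq t (by omega))
    rw [if_pos (by omega)]
    by_cases h : s + t = m + n
    · rw [if_pos (by omega), show m + n - t = s by omega, show m + n - s = t by omega,
        π_self hσ, π_self hσ, LinearMap.id_apply, LinearMap.id_apply, hc, sub_self]
    · rw [π_eq_zero (by omega), LinearMap.zero_apply, mul_zero, zero_sub, neg_eq_zero,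
        ite_eq_right_iff]
      intro h3
      rw [π_eq_zero (by omega), LinearMap.zero_apply, mul_zero]
  rw [coeff_mul p q, coeff_mul q p, Finset.sum_comm (s := q.support), ← Finset.sum_sub_distrib,
    Finset.sum_eq_single (m + 1)]
  · rw [← Finset.sum_sub_distrib, Finset.sum_eq_single n]
    · rw [if_pos (by omega), Nat.add_sub_cancel, π_succ_self hσ, mul_smul_comm]
      congr 1
      -- For `n = 0` the exponent `m + 1` exceeds `m + n`, so the second term is absent, in
      -- agreement with the factor `n`.
      rcases n with _ | n
      · rw [if_neg (by omega), zero_smul]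
      · rw [if_pos (by omega), show m + (n + 1) - (m + 1) = n by omega, π_succ_self hσ,
          mul_smul_comm]
    · intro t ht htn
      by_cases hs : m + 1 ∈ p.support
      · exact key _ hs t ht (Or.inr htn)
      · rw [mem_support, not_not] at hs
        simp [hs]
    · intro h
      rw [mem_support, not_not] at h
      simp [h]
  · intro s hs hsm
    rw [← Finset.sum_sub_distrib]
    exact Finset.sum_eq_zero fun t ht => key s hs t ht (Or.inl hsm)
  · intro h
    rw [mem_support, not_not] at h
    simp [h]

/-! ### The indeterminate `x` and the nucleus -/

variable (D) in
/-- The indeterminate `x`. -/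
noncomputable def X : OreExtension D := monomial 1 1

theorem monomial_mul_X (n : ℕ) (r : R) :
    (monomial n r * X D : OreExtension D) = monomial (n + 1) r := by
  ext k
  rw [X, coeff_monomial_mul_monomial, coeff_monomial, OreData.π_one]
  split_ifs <;> first | omega | simp

theorem X_mul_monomial (hσ : D.σ = LinearMap.id) (n : ℕ) (r : R) :
    (X D * monomial n r : OreExtension D) = monomial (n + 1) r + monomial n (D.δ r) := by
  rw [X, monomial_mul_monomial, monomialMul, Finset.sum_range_succ, Finset.sum_range_one,
    π_self hσ]
  simp [OreData.π, add_comm]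

theorem monomial_mul_mul_X (m : ℕ) (r : R) (n : ℕ) (s : R) :
    (monomial m r * (monomial n s * X D) : OreExtension D) =
      monomial m r * monomial n s * X D := by
  simp only [monomial_mul_X, monomial_mul_monomial, monomialMul, Finset.sum_mul, add_assoc]

/-- This is the Pascal-type recursion defining `π`, once `δ` is moved past `π`. -/
theorem monomial_mul_X_mul (hσ : D.σ = LinearMap.id) (m : ℕ) (r : R) (n : ℕ) (s : R) :
    (monomial m r * (X D * monomial n s) : OreExtension D) =
      monomial m r * X D * monomial n s := by
  ext k
  simp only [X_mul_monomial hσ, mul_add, coeff_add, monomial_mul_X, coeff_monomial_mul_monomial]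
  rcases lt_trichotomy k n with h | rfl | h
  · simp [show ¬ n ≤ k by omega, show ¬ n + 1 ≤ k by omega]
  · simp [OreData.π, δ_π hσ]
  · obtain ⟨i, rfl⟩ := Nat.exists_eq_add_of_lt h
    simp [OreData.π, δ_π hσ, hσ, show n + i + 1 - n = i + 1 by omega,
      show n + i + 1 - (n + 1) = i by omega, mul_add, show n ≤ n + i + 1 by omega]

/-- Here the Leibniz rule for `δ` is what makes `x` associate from the left. -/
theorem X_mul_monomial_mul (hσ : D.σ = LinearMap.id) (m : ℕ) (r : R) (n : ℕ) (s : R) :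
    (X D * (monomial m r * monomial n s) : OreExtension D) =
      X D * monomial m r * monomial n s := by
  rw [X_mul_monomial hσ m r, add_mul, ← monomial_mul_X, ← monomial_mul_X_mul hσ,
    X_mul_monomial hσ, mul_add, monomial_mul_monomial, monomial_mul_monomial,
    monomial_mul_monomial, monomial_mul_monomial]
  simp only [monomialMul, Finset.mul_sum, X_mul_monomial hσ, ← Finset.sum_add_distrib]
  refine Finset.sum_congr rfl fun i _ => ?_
  rw [D.δ_mul, hσ, monomial_add, LinearMap.id_apply, δ_π hσ, add_assoc, add_assoc]

theorem monomial_zero_mul_monomial (r : R) (n : ℕ) (s : R) :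
    (monomial 0 r * monomial n s : OreExtension D) = monomial n (r * s) := by
  rw [monomial_mul_monomial]
  simp [monomialMul, OreData.π]

section Nucleus

variable [IsScalarTower K R R] [SMulCommClass K R R]

/-- Membership of the nucleus can be checked on monomials. -/
theorem mem_nucleus_of_monomial {a : OreExtension D}
    (h1 : ∀ (m : ℕ) (r : R) (n : ℕ) (s : R), a * (monomial m r * monomial n s) =
      a * monomial m r * monomial n s)
    (h2 : ∀ (m : ℕ) (r : R) (n : ℕ) (s : R), monomial m r * (a * monomial n s) =
      monomial m r * a * monomial n s)
    (h3 : ∀ (m : ℕ) (r : R) (n : ℕ) (s : R), monomial m r * (monomial n s * a) =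
      monomial m r * monomial n s * a) :
    a ∈ nucleus K (OreExtension D) := by
  refine ⟨fun b c => ?_, fun b c => ?_, fun b c => ?_⟩ <;>
  · rw [← sum_monomial b, ← sum_monomial c]
    simp only [Finset.sum_mul, Finset.mul_sum, h1, h2, h3]

theorem X_mem_nucleus (hσ : D.σ = LinearMap.id) : X D ∈ nucleus K (OreExtension D) :=
  mem_nucleus_of_monomial (X_mul_monomial_mul hσ) (monomial_mul_X_mul hσ) monomial_mul_mul_X

/-- An element `r` of the nucleus of `R` with `δ(r) = 1` belongs to the nucleus of
`R[x; id, δ]`. -/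
theorem monomial_zero_mem_nucleus (hσ : D.σ = LinearMap.id) {r : R} (hr : r ∈ nucleus K R)
    (hδ : D.δ r = 1) :
    (monomial 0 r : OreExtension D) ∈ nucleus K (OreExtension D) := by
  obtain ⟨x1, x2, x3⟩ := X_mem_nucleus (K := K) hσ
  obtain ⟨r1, r2, r3⟩ := hr
  set x := X D
  set y : OreExtension D := monomial 0 r with hy
  have hxy : x * y = y * x + 1 := by
    rw [hy, X_mul_monomial hσ, monomial_mul_X, hδ]
    rfl
  have hx : ∀ s, x * monomial 0 s = monomial 0 s * x + monomial 0 (D.δ s) := fun s => by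
    rw [X_mul_monomial hσ, monomial_mul_X]
  have hy2 : ∀ m s c, monomial m s * (y * c) = monomial m s * y * c := by
    intro m s c
    -- Moving `x` past `y` turns the third factor into `x * c`, so `c` has to vary.
    induction m generalizing c with
    | zero =>
      rw [← sum_monomial c]
      simp only [Finset.mul_sum, hy, monomial_zero_mul_monomial, r2]
    | succ m ih =>
      set b : OreExtension D := monomial m s
      rw [← monomial_mul_X]
      calc b * x * (y * c) = b * (x * (y * c)) := (x2 _ _).symm
        _ = b * (x * y * c) := by rw [x1]
        _ = b * (y * (x * c)) + b * c := by rw [hxy, add_mul, one_mul, mul_add, ← x2]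
        _ = (b * (y * x) + b) * c := by rw [ih, x2, add_mul, ← x3]
        _ = b * x * y * c := by rw [← x2 b y, hxy, mul_add, mul_one]
  refine mem_nucleus_of_monomial ?_ (fun m s n t => hy2 m s _) ?_
  · intro m s n t
    rw [hy, monomial_zero_mul_monomial, monomial_mul_monomial, monomial_mul_monomial]
    simp only [monomialMul, Finset.mul_sum, monomial_zero_mul_monomial, r1]
  · intro m s n t
    -- Moving `x` past the constant `t` creates `δ t`, so the induction on `m` needs all `t`. Powers
    -- of `x` in the second factor come afterwards.
    have base : ∀ t, monomial m s * (monomial 0 t * y) = monomial m s * monomial 0 t * y := by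
      induction m with
      | zero =>
        intro t
        simp only [hy, monomial_zero_mul_monomial, r3]
      | succ m ih =>
        intro t
        set b : OreExtension D := monomial m s
        set c : OreExtension D := monomial 0 t
        rw [← monomial_mul_X]
        calc b * x * (c * y) = b * (x * c * y) := by rw [← x2, x1]
          _ = b * (c * (x * y)) + b * (monomial 0 (D.δ t) * y) := by
            rw [hx t, add_mul, mul_add, ← x2]
          _ = b * c * y * x + b * c + b * monomial 0 (D.δ t) * y := by
            rw [hxy, mul_add, mul_add, mul_one, x3 c, x3 b, ih, ih]
          _ = b * c * (x * y) + b * monomial 0 (D.δ t) * y := by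
            rw [hxy, mul_add, mul_one, x3]
          _ = b * (x * c) * y := by rw [hx t, mul_add, add_mul, x2, x3]
          _ = b * x * c * y := by rw [x2]
    induction n with
    | zero => exact base t
    | succ n ih =>
      set b : OreExtension D := monomial m s
      set c : OreExtension D := monomial n t
      rw [← monomial_mul_X]
      calc b * (c * x * y) = b * (c * (y * x)) + b * c := by
            rw [← x2 c, hxy, mul_add, mul_add, mul_one]
        _ = b * c * y * x + b * c := by rw [x3, x3, ih]
        _ = b * c * (x * y) := by rw [hxy, mul_add, mul_one, x3]
        _ = b * (c * x) * y := by rw [x2, x3]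

end Nucleus

end OreExtension

open OreExtension

/-! ### The octonions: no zero divisors, dimension 8 -/

/-- The identity `(uv)v̄ = |v|² u`, read off in quaternion components, shows that `uv = 0` forces
`|v|² u = 0`. -/
instance : NoZeroDivisors Octonion where
  eq_zero_or_eq_zero_of_mul_eq_zero {u v} h := by
    have h1 : u.1 * v.1 = star v.2 * u.2 := sub_eq_zero.1 (congrArg Prod.fst h)
    have h2 : v.2 * u.1 = -(u.2 * star v.1) := eq_neg_of_add_eq_zero_left (congrArg Prod.snd h)
    have hc : ∀ q r : ℍ[ℝ], q * (r * star r) = (Quaternion.normSq r) • q := fun q r => by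
      rw [Quaternion.self_mul_star, Quaternion.mul_coe_eq_smul]
    have hc' : ∀ q r : ℍ[ℝ], (star r * r) * q = (Quaternion.normSq r) • q := fun q r => by
      rw [Quaternion.star_mul_self, Quaternion.coe_mul_eq_smul]
    have e1 : (Quaternion.normSq v.1 + Quaternion.normSq v.2) • u.1 = 0 := by
      rw [add_smul, ← hc, ← hc', ← mul_assoc, h1, mul_assoc (star v.2) v.2, h2, mul_neg,
        mul_assoc, add_neg_cancel]
    have e2 : (Quaternion.normSq v.1 + Quaternion.normSq v.2) • u.2 = 0 := by
      have h3 : Quaternion.normSq v.1 • u.2 = u.2 * star v.1 * v.1 := by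
        rw [mul_assoc, Quaternion.star_mul_self, Quaternion.mul_coe_eq_smul]
      have h4 : Quaternion.normSq v.2 • u.2 = v.2 * (star v.2 * u.2) := by
        rw [← mul_assoc, Quaternion.self_mul_star, Quaternion.coe_mul_eq_smul]
      rw [add_smul, h3, h4, ← h1, ← mul_assoc, h2, neg_mul, add_neg_cancel]
    by_cases hv : Quaternion.normSq v.1 + Quaternion.normSq v.2 = 0
    · right
      have h3 := Quaternion.normSq_nonneg (a := v.1)
      have h4 := Quaternion.normSq_nonneg (a := v.2)
      exact Octonion.ext (Quaternion.normSq_eq_zero.1 (by linarith))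
        (Quaternion.normSq_eq_zero.1 (by linarith))
    · left
      exact Octonion.ext ((smul_eq_zero.1 e1).resolve_left hv)
        ((smul_eq_zero.1 e2).resolve_left hv)

instance : Module.Finite ℝ Octonion := inferInstanceAs (Module.Finite ℝ (ℍ[ℝ] × ℍ[ℝ]))

theorem Octonion.finrank_eq : Module.finrank ℝ Octonion = 8 := by
  change Module.finrank ℝ (ℍ[ℝ] × ℍ[ℝ]) = 8
  rw [Module.finrank_prod, Quaternion.finrank_eq_four]

instance : NoZeroDivisors (Poly ℝ Octonion) := noZeroDivisors rfl

instance : NoZeroDivisors OctDiffRing := noZeroDivisors rfl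

/-! ### Polynomials in `y` and the leading-coefficient relation -/

namespace Poly

variable {K A : Type*} [Field K] [NonAssocRing A] [Module K A]

theorem coeff_derivative (p : Poly K A) (n : ℕ) :
    (derivative p).coeff n = ((n : K) + 1) • p.coeff (n + 1) := by
  rw [← sum_monomial p, map_sum, coeff_sum, coeff_sum, Finset.smul_sum]
  refine Finset.sum_congr rfl fun m _ => ?_
  rw [derivative_monomial, coeff_monomial, coeff_monomial]
  rcases m with _ | m
  · simp
  · simp only [Nat.add_sub_cancel, add_left_inj]
    split_ifs with h
    · simp [h]
    · simp

/-- Writing `k + 1 = e + d` avoids a truncated subtraction and covers `d = 0`, where `q' = 0`. -/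
theorem coeff_mul_derivative [SMulCommClass K A A] {p q : Poly K A} {d e k : ℕ}
    (hp : ∀ i, e < i → p.coeff i = 0) (hq : ∀ i, d < i → q.coeff i = 0) (hk : k + 1 = e + d) :
    (p * derivative q).coeff k = (d : K) • (p.coeff e * q.coeff d) := by
  rcases d with _ | d
  · have : derivative q = 0 := ext_coeff fun n => by
      rw [coeff_derivative, hq _ (Nat.succ_pos n), smul_zero, coeff_zero]
    rw [this, mul_zero, coeff_zero, Nat.cast_zero, zero_smul]
  · obtain rfl : k = e + d := by omega
    rw [coeff_mul_add rfl hp (fun i hi => ?_), coeff_derivative, mul_smul_comm, Nat.cast_succ]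
    rw [coeff_derivative, hq _ (by omega), smul_zero]

/-- Leading coefficients of solutions of `n p q' = m q p'`. -/
theorem natDegree_relation [CharZero K] [IsScalarTower K A A] [SMulCommClass K A A]
    [NoZeroDivisors A] {p q : Poly K A} {d e m n : ℕ}
    (hp : ∀ i, e < i → p.coeff i = 0) (hq : ∀ i, d < i → q.coeff i = 0)
    (hpe : p.coeff e ≠ 0) (hqd : q.coeff d ≠ 0)
    (hc : p.coeff e * q.coeff d = q.coeff d * p.coeff e)
    (h : n • (p * derivative q) = m • (q * derivative p)) : n * d = m * e := by
  rcases Nat.eq_zero_or_pos (e + d) with h0 | h0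
  · obtain ⟨rfl, rfl⟩ : e = 0 ∧ d = 0 := by omega
    simp
  · obtain ⟨k, hk⟩ := Nat.exists_eq_succ_of_ne_zero h0.ne'
    have h1 := congrArg (lcoeff (polyData K A) k) h
    rw [map_nsmul, map_nsmul, lcoeff_apply, lcoeff_apply,
      coeff_mul_derivative hp hq hk.symm, coeff_mul_derivative hq hp (by omega), ← hc,
      ← Nat.cast_smul_eq_nsmul K, ← Nat.cast_smul_eq_nsmul K, smul_smul, smul_smul] at h1
    have h2 := smul_left_injective K (mul_ne_zero hpe hqd) h1
    exact_mod_cast h2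

theorem monomial_mem_nucleus [IsScalarTower K A A] [SMulCommClass K A A] (n : ℕ) (k : K) :
    (monomial n (k • 1) : Poly K A) ∈ nucleus K (Poly K A) := by
  apply mem_nucleus_of_monomial <;> intros <;>
    simp [Poly.monomial_mul_monomial, add_comm, add_left_comm, smul_mul_assoc,
      mul_smul_comm]

theorem mul_comm_of_coeff [IsScalarTower K A A] [SMulCommClass K A A] {p : Poly K A}
    (hp : ∀ i, ∃ k : K, p.coeff i = k • 1) (q : Poly K A) : p * q = q * p := by
  rw [← sum_monomial p, ← sum_monomial q]
  simp only [Finset.sum_mul, Finset.mul_sum, Poly.monomial_mul_monomial]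
  rw [Finset.sum_comm]
  refine Finset.sum_congr rfl fun s _ => Finset.sum_congr rfl fun t _ => ?_
  obtain ⟨k, hk⟩ := hp s
  rw [hk, smul_mul_assoc, mul_smul_comm, one_mul, mul_one, add_comm]

end Poly

/-! ### Elements of the nucleus of `T` -/

theorem octY_mem_nucleus : octY ∈ nucleus ℝ OctDiffRing := by
  refine monomial_zero_mem_nucleus rfl ?_ ?_
  · simpa [polyY] using Poly.monomial_mem_nucleus (A := Octonion) 1 (1 : ℝ)
  · refine (Poly.derivative_monomial _ _).trans ?_
    simp only [Nat.cast_one, one_smul]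
    rfl

theorem one_mem_nucleus {K S : Type*} [Field K] [NonAssocRing S] [Module K S]
    [IsScalarTower K S S] [SMulCommClass K S S] : (1 : S) ∈ nucleus K S := by
  refine ⟨?_, ?_, ?_⟩ <;> simp

/-- The nucleus is a subalgebra containing `y` and `x`, and `a` is a real combination of the
products `y^i x^n`. -/
theorem mem_nucleus_of_hasRealPolyCoeffs {a : OctDiffRing} (ha : HasRealPolyCoeffs a) :
    a ∈ nucleus ℝ OctDiffRing := by
  have hy : ∀ i : ℕ, (monomial 0 (monomial i 1) : OctDiffRing) ∈ nucleus ℝ OctDiffRing := by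
    intro i
    induction i with
    | zero => exact one_mem_nucleus
    | succ i ih =>
      have : (monomial 0 (monomial (i + 1) 1) : OctDiffRing) =
          octY * monomial 0 (monomial i 1) := by
        rw [octY, monomial_zero_mul_monomial, polyY, Poly.monomial_mul_monomial, one_mul,
          add_comm]
      rw [this]
      exact mul_mem octY_mem_nucleus ih
  have hx : ∀ n i : ℕ, (monomial n (monomial i 1) : OctDiffRing) ∈ nucleus ℝ OctDiffRing := by
    intro n i
    induction n with
    | zero => exact hy i
    | succ n ih =>
      rw [← monomial_mul_X]
      exact mul_mem ih (X_mem_nucleus rfl)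
  rw [← sum_monomial a]
  refine sum_mem fun n _ => ?_
  rw [← sum_monomial (a.coeff n)]
  have : (monomial n (∑ i ∈ (a.coeff n).support, monomial i ((a.coeff n).coeff i)) :
      OctDiffRing) = ∑ i ∈ (a.coeff n).support, monomial n (monomial i ((a.coeff n).coeff i)) :=
    map_sum (AddMonoidHom.mk' (monomial n : Poly ℝ Octonion → OctDiffRing) (monomial_add n)) _ _
  rw [this]
  refine sum_mem fun i _ => ?_
  obtain ⟨r, hr⟩ := ha n i
  rw [hr, ← smul_monomial, ← smul_monomial]
  exact SMulMemClass.smul_mem r (hx n i)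

/-! ### Centralizers as modules over `K[a]` -/

section Generic

variable {K S : Type*} [Field K] [NonAssocRing S] [Module K S]
  [IsScalarTower K S S] [SMulCommClass K S S]

variable (K) in
/-- The centralizer of an element, as a `K`-subspace. -/
noncomputable def centralizerSubspace (a : S) : Submodule K S :=
  LinearMap.ker (LinearMap.mulLeft K a - LinearMap.mulRight K a)

theorem mem_centralizerSubspace {a b : S} : b ∈ centralizerSubspace K a ↔ a * b = b * a := by
  simp [centralizerSubspace, sub_eq_zero]

theorem mem_centralizer_iff {a b : S} :
    b ∈ Set.centralizer {a} ↔ b ∈ centralizerSubspace K a := by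
  simp [Set.mem_centralizer_iff, mem_centralizerSubspace]

theorem mem_centralizerModule_iff {a b : S} {ha : a ∈ nucleus K S} :
    b ∈ centralizerModule K a ha ↔ b ∈ centralizerSubspace K a :=
  mem_centralizer_iff

theorem mul_mem_centralizerSubspace {a b : S} (ha : a ∈ nucleus K S)
    (hb : b ∈ centralizerSubspace K a) : a * b ∈ centralizerSubspace K a := by
  rw [mem_centralizerSubspace] at *
  rw [← ha.1, ← hb]

/-- Allows spans over `K` to be compared with spans over `K[a]`. -/
instance (a : S) (ha : a ∈ nucleus K S) : IsScalarTower K (algebraGenerated K a ha) S where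
  smul_assoc r s t := smul_mul_assoc r ((s : nucleus K S) : S) t

/-- If `S` has no zero divisors and `C_S(a)` is finite over `K[a]`, then it is free over `K[a]`. -/
theorem free_centralizerModule [NoZeroDivisors S] [Nontrivial S] (a : S) (ha : a ∈ nucleus K S)
    [Module.Finite (algebraGenerated K a ha) (centralizerModule K a ha)] :
    Module.Free (algebraGenerated K a ha) (centralizerModule K a ha) := by
  have := Algebra.isMulCommutative_adjoin K (s := {(⟨a, ha⟩ : nucleus K S)})
    (by rintro _ rfl _ rfl; rfl)
  let : CommRing (algebraGenerated K a ha) :=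
    { (inferInstance : Ring (algebraGenerated K a ha)) with mul_comm := this.is_comm.comm }
  have hmul : ∀ r s : algebraGenerated K a ha, r * s = 0 → r = 0 ∨ s = 0 := by
    intro r s h
    have h' : ((r : nucleus K S) : S) * ((s : nucleus K S) : S) = 0 :=
      congrArg (fun t : algebraGenerated K a ha => ((t : nucleus K S) : S)) h
    rcases mul_eq_zero.1 h' with h | h
    · exact Or.inl (Subtype.ext (Subtype.ext h))
    · exact Or.inr (Subtype.ext (Subtype.ext h))
  have : NoZeroDivisors (algebraGenerated K a ha) := ⟨hmul _ _⟩
  have : Nontrivial (algebraGenerated K a ha) := by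
    refine ⟨0, 1, fun h => zero_ne_one (α := S) ?_⟩
    exact congrArg (fun t : algebraGenerated K a ha => ((t : nucleus K S) : S)) h
  have : IsDomain (algebraGenerated K a ha) := NoZeroDivisors.to_isDomain _
  -- Evaluation at `a` maps the polynomial ring `K[t]` onto `K[a]`, and principality of ideals
  -- passes to quotients.
  have : IsPrincipalIdealRing (algebraGenerated K a ha) := by
    have hmem : ∀ p : Polynomial K, Polynomial.aeval (⟨a, ha⟩ : nucleus K S) p ∈
        algebraGenerated K a ha := fun p => Polynomial.aeval_mem_adjoin_singleton K _
    let f : Polynomial K →ₐ[K] algebraGenerated K a ha :=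
      (Polynomial.aeval (⟨a, ha⟩ : nucleus K S)).codRestrict _ hmem
    refine IsPrincipalIdealRing.of_surjective f fun x => ?_
    have hx : (x : nucleus K S) ∈ Algebra.adjoin K {(⟨a, ha⟩ : nucleus K S)} := x.2
    rw [Algebra.adjoin_singleton_eq_range_aeval] at hx
    obtain ⟨p, hp⟩ := hx
    exact ⟨p, Subtype.ext hp⟩
  have : Module.IsTorsionFree (algebraGenerated K a ha) (centralizerModule K a ha) := by
    refine Module.IsTorsionFree.of_smul_eq_zero fun r b h => ?_
    have h' : ((r : nucleus K S) : S) * (b : S) = 0 := congrArg Subtype.val h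
    rcases mul_eq_zero.1 h' with h | h
    · exact Or.inl (Subtype.ext (Subtype.ext h))
    · exact Or.inr (Subtype.ext h)
  exact Module.free_of_finite_type_torsion_free'

end Generic

/-! ### Leading symbols and condition `D(8)` -/

/-- For `b` of degree at most `m` in the centralizer of `a`, where `a` has degree `n` in `x` and
its leading coefficient has degree `e` in `y`, this is the leading coefficient in `y` of the
coefficient of `xᵐ`. -/
noncomputable def leadSymbol (n e m : ℕ) : OctDiffRing →ₗ[ℝ] Octonion :=
  lcoeff (polyData ℝ Octonion) (m * e / n) ∘ₗ lcoeff (diffData ℝ Octonion) m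

theorem leadSymbol_apply (n e m : ℕ) (b : OctDiffRing) :
    leadSymbol n e m b = (b.coeff m).coeff (m * e / n) :=
  rfl

/-- The elements of degree at most `m`. -/
noncomputable def degreeLE (m : ℕ) : Submodule ℝ OctDiffRing where
  carrier := {p | ∀ k, m < k → p.coeff k = 0}
  zero_mem' _ _ := rfl
  add_mem' hp hq k hk := by rw [coeff_add, hp k hk, hq k hk, add_zero]
  smul_mem' c p hp k hk := by rw [coeff_smul, hp k hk, smul_zero]

/-- `a` has degree `n` in `x`, its leading coefficient has degree `e` in `y`, and `n` is
positive. -/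
structure HasBidegree (a : OctDiffRing) (n e : ℕ) : Prop where
  pos : 0 < n
  coeff_eq_zero : ∀ k, n < k → a.coeff k = 0
  coeff_coeff_ne_zero : (a.coeff n).coeff e ≠ 0
  coeff_coeff_eq_zero : ∀ i, e < i → (a.coeff n).coeff i = 0

theorem exists_hasBidegree {a : OctDiffRing} (ha : 0 < a.degree) :
    ∃ n e, HasBidegree a n e := by
  have h0 : a ≠ 0 := by
    rintro rfl
    rw [degree_zero] at ha
    exact not_lt_bot ha
  obtain ⟨n, h1, h2, h3⟩ := exists_degree_eq h0
  obtain ⟨e, -, h4, h5⟩ := exists_degree_eq h2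
  refine ⟨n, e, ?_, h3, h4, h5⟩
  rw [h1] at ha
  exact_mod_cast ha

section

variable {a b : OctDiffRing} {n e m : ℕ}

theorem HasBidegree.mul_natDegree_eq (h : HasBidegree a n e) (ha : HasRealPolyCoeffs a)
    (hb : b ∈ centralizerSubspace ℝ a) (hm : b ∈ degreeLE m) {d : ℕ}
    (hd : (b.coeff m).coeff d ≠ 0) (hd' : ∀ i, d < i → (b.coeff m).coeff i = 0) :
    n * d = m * e := by
  obtain ⟨N, rfl⟩ := Nat.exists_eq_succ_of_ne_zero h.pos.ne'
  have h1 := coeff_mul_sub_mul (D := diffData ℝ Octonion) rfl h.coeff_eq_zero hm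
    (fun s r => Poly.mul_comm_of_coeff (ha s) r)
  rw [mem_centralizerSubspace.1 hb, sub_self, eq_comm, sub_eq_zero] at h1
  refine Poly.natDegree_relation h.coeff_coeff_eq_zero hd' h.coeff_coeff_ne_zero hd ?_ h1
  obtain ⟨r, hr⟩ := ha (N + 1) e
  rw [hr, smul_mul_assoc, mul_smul_comm, one_mul, mul_one]

/-- A non-zero coefficient of `x^m` has degree `d` with `n * d = m * e`, so the division is exact
and the symbol is its true top coefficient. If `n` does not divide `m * e`, that coefficient is zero
and rounding is harmless. -/
theorem HasBidegree.coeff_cases (h : HasBidegree a n e) (ha : HasRealPolyCoeffs a)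
    (hb : b ∈ centralizerSubspace ℝ a) (hm : b ∈ degreeLE m) :
    (b.coeff m = 0 ∨ leadSymbol n e m b ≠ 0) ∧
      ∀ i, m * e / n < i → (b.coeff m).coeff i = 0 := by
  by_cases h0 : b.coeff m = 0
  · exact ⟨Or.inl h0, fun i _ => by rw [h0, coeff_zero]⟩
  · obtain ⟨d, -, h1, h2⟩ := exists_degree_eq h0
    have h3 : m * e / n = d := by
      rw [← h.mul_natDegree_eq ha hb hm h1 h2, Nat.mul_div_cancel_left _ h.pos]
    rw [leadSymbol_apply, h3]
    exact ⟨Or.inr h1, h2⟩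

theorem HasBidegree.coeff_eq_zero_of_leadSymbol (h : HasBidegree a n e)
    (ha : HasRealPolyCoeffs a) (hb : b ∈ centralizerSubspace ℝ a) (hm : b ∈ degreeLE m)
    (h0 : leadSymbol n e m b = 0) : b.coeff m = 0 :=
  (h.coeff_cases ha hb hm).1.resolve_right (not_not.2 h0)

theorem HasBidegree.conditionD (h : HasBidegree a n e) (ha : HasRealPolyCoeffs a) :
    ConditionD ℝ (degree : OctDiffRing → WithBot ℤ) (Set.centralizer {a}) 8 := by
  refine ⟨fun b _ hb0 => ?_, fun b hb hd => ?_⟩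
  · obtain ⟨m, hm, -⟩ := exists_degree_eq hb0
    rw [hm]
    exact_mod_cast Int.natCast_nonneg m
  · obtain ⟨d, hd⟩ := hd
    have hb0 : b 0 ≠ 0 := by
      intro h0
      have := hd 0
      rw [h0, degree_zero] at this
      exact WithBot.bot_ne_coe this
    obtain ⟨m, hm, -⟩ := exists_degree_eq hb0
    have hbm : ∀ i, b i ∈ degreeLE m := fun i =>
      (coeff_ne_zero_of_degree_eq ((hd i).trans ((hd 0).symm.trans hm))).2
    -- Nine vectors in the 8-dimensional space `𝕆`.
    have hdep : ¬ LinearIndependent ℝ fun i => leadSymbol n e m (b i) := by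
      intro hli
      have := hli.fintype_card_le_finrank
      rw [Octonion.finrank_eq] at this
      simp at this
    obtain ⟨α, hα, i, hi⟩ := Fintype.not_linearIndependent_iff.1 hdep
    refine ⟨α, ⟨i, hi⟩, ?_⟩
    have h1 : ∑ i, α i • b i ∈ centralizerSubspace ℝ a :=
      sum_mem fun i _ => Submodule.smul_mem _ _ (mem_centralizer_iff.1 (hb i))
    have h2 : ∑ i, α i • b i ∈ degreeLE m :=
      sum_mem fun i _ => Submodule.smul_mem _ _ (hbm i)
    have h3 := h.coeff_eq_zero_of_leadSymbol ha h1 h2 (by simpa using hα)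
    rw [hm]
    refine degree_lt_of_coeff_eq_zero fun k hk => ?_
    rcases hk.eq_or_lt with rfl | hk
    · exact h3
    · exact h2 k hk

/-! ### Stabilisation of symbol spaces and finite generation -/

/-- The leading symbols of the elements of degree at most `m` of the centralizer. -/
noncomputable def symbolSpace (a : OctDiffRing) (n e m : ℕ) : Submodule ℝ Octonion :=
  (centralizerSubspace ℝ a ⊓ degreeLE m).map (leadSymbol n e m)

theorem HasBidegree.mul_mem_degreeLE (h : HasBidegree a n e) (hm : b ∈ degreeLE m) :
    a * b ∈ degreeLE (m + n) :=
  fun _ hk => coeff_mul_of_lt h.coeff_eq_zero hm (by omega)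

/-- Multiplication by `a` rescales leading symbols by a non-zero real number. -/
theorem HasBidegree.exists_leadSymbol_mul (h : HasBidegree a n e) (ha : HasRealPolyCoeffs a) :
    ∃ r : ℝ, r ≠ 0 ∧ ∀ m, ∀ b ∈ centralizerSubspace ℝ a ⊓ degreeLE m,
      leadSymbol n e (m + n) (a * b) = r • leadSymbol n e m b := by
  obtain ⟨r, hr⟩ := ha n e
  refine ⟨r, ?_, fun m b hb => ?_⟩
  · rintro rfl
    exact h.coeff_coeff_ne_zero (by rw [hr, zero_smul])
  -- This holds even when the division rounds. The product formula for top coefficients is then used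
  -- twice, in `x` and in `y`.
  · have h1 : (m + n) * e / n = e + m * e / n := by
      rw [add_mul, Nat.add_mul_div_left _ _ h.pos, add_comm]
    rw [leadSymbol_apply, leadSymbol_apply, h1, add_comm m n, coeff_mul_add rfl h.coeff_eq_zero
      hb.2, coeff_mul_add rfl h.coeff_coeff_eq_zero (h.coeff_cases ha hb.1 hb.2).2, hr,
      smul_mul_assoc, one_mul]

theorem HasBidegree.symbolSpace_le (h : HasBidegree a n e) (ha : HasRealPolyCoeffs a) (m : ℕ) :
    symbolSpace a n e m ≤ symbolSpace a n e (m + n) := by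
  obtain ⟨r, hr, hmul⟩ := h.exists_leadSymbol_mul ha
  rintro _ ⟨b, hb, rfl⟩
  refine ⟨r⁻¹ • (a * b), Submodule.smul_mem _ _
    ⟨mul_mem_centralizerSubspace (mem_nucleus_of_hasRealPolyCoeffs ha) hb.1,
      h.mul_mem_degreeLE hb.2⟩, ?_⟩
  rw [map_smul, hmul m b hb, inv_smul_smul₀ hr]

/-- Each residue class mod `n` gives an ascending chain of subspaces of `𝕆`, which is Noetherian;
there are only finitely many classes. -/
theorem HasBidegree.exists_symbolSpace_eq (h : HasBidegree a n e) (ha : HasRealPolyCoeffs a) :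
    ∃ M, ∀ m, M ≤ m → symbolSpace a n e (m + n) = symbolSpace a n e m := by
  have hst : ∀ i, ∃ k₀, ∀ k, k₀ ≤ k →
      symbolSpace a n e (i + k₀ * n) = symbolSpace a n e (i + k * n) := by
    intro i
    refine monotone_stabilizes_iff_noetherian.2 inferInstance
      ⟨fun k => symbolSpace a n e (i + k * n), monotone_nat_of_le_succ fun k => ?_⟩
    rw [add_mul, one_mul, ← add_assoc]
    exact h.symbolSpace_le ha _
  choose k₀ hk₀ using hst
  -- The factor `n` guarantees that `m / n` is past the threshold of every residue class.
  refine ⟨(Finset.range n).sup k₀ * n, fun m hm => ?_⟩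
  have h1 : k₀ (m % n) ≤ m / n :=
    (Finset.le_sup (Finset.mem_range.2 (Nat.mod_lt m h.pos))).trans
      ((Nat.le_div_iff_mul_le h.pos).2 hm)
  have h2 : m % n + m / n * n = m := Nat.mod_add_div' m n
  have h3 := hk₀ _ _ h1
  have h4 := hk₀ _ _ (h1.trans (Nat.le_succ _))
  rw [Nat.succ_mul, ← add_assoc, h2] at h4
  rw [h2] at h3
  rw [← h4, h3]

/-- The symbols at all levels up to `M` jointly embed this space in `𝕆^(M+1)`: the one at the exact
degree of a non-zero element is non-zero. -/
theorem HasBidegree.fg_degreeLE (h : HasBidegree a n e) (ha : HasRealPolyCoeffs a) (M : ℕ) :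
    (centralizerSubspace ℝ a ⊓ degreeLE M).FG := by
  rw [← Module.Finite.iff_fg]
  let f : ↥(centralizerSubspace ℝ a ⊓ degreeLE M) →ₗ[ℝ] Fin (M + 1) → Octonion :=
    LinearMap.pi fun m => leadSymbol n e m ∘ₗ Submodule.subtype _
  refine Module.Finite.of_injective f ((injective_iff_map_eq_zero f).2 fun b hb => ?_)
  by_contra hb0
  obtain ⟨m, -, h1, h2⟩ := exists_degree_eq fun h0 => hb0 (Subtype.ext h0)
  have h3 : m < M + 1 := by
    by_contra hlt
    exact h1 (b.2.2 m (by omega))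
  exact h1 (h.coeff_eq_zero_of_leadSymbol ha b.2.1 h2 (congrFun hb ⟨m, h3⟩))

theorem HasBidegree.fg_centralizerModule (h : HasBidegree a n e) (ha : HasRealPolyCoeffs a)
    (ha' : a ∈ nucleus ℝ OctDiffRing) : (centralizerModule ℝ a ha').FG := by
  obtain ⟨r, hr, hmul⟩ := h.exists_leadSymbol_mul ha
  obtain ⟨M, hM⟩ := h.exists_symbolSpace_eq ha
  -- An element of degree `k > M + n` has `k - n > M`, in the stable range, so its symbol already
  -- occurs at level `k - n`.
  obtain ⟨s, hs⟩ := h.fg_degreeLE ha (M + n)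
  refine ⟨s, le_antisymm (Submodule.span_le.2 fun b hb => ?_) fun b hb => ?_⟩
  · have hb' : b ∈ centralizerSubspace ℝ a ⊓ degreeLE (M + n) := hs ▸ Submodule.subset_span hb
    exact mem_centralizerModule_iff.2 hb'.1
  · rw [mem_centralizerModule_iff] at hb
    have hsmall : ∀ b ∈ centralizerSubspace ℝ a ⊓ degreeLE (M + n),
        b ∈ Submodule.span (algebraGenerated ℝ a ha') (s : Set OctDiffRing) := fun b hb => by
      rw [← hs] at hb
      exact Submodule.span_le_restrictScalars ℝ (algebraGenerated ℝ a ha') _ hb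
    have key : ∀ k, ∀ b ∈ centralizerSubspace ℝ a, (∀ j, k ≤ j → b.coeff j = 0) →
        b ∈ Submodule.span (algebraGenerated ℝ a ha') (s : Set OctDiffRing) := by
      intro k
      induction k with
      | zero => exact fun b hb hk => hsmall b ⟨hb, fun j _ => hk j (Nat.zero_le j)⟩
      | succ k ih =>
        intro b hb hk
        rcases le_or_gt k (M + n) with hkM | hkM
        · exact hsmall b ⟨hb, fun j hj => hk j (by omega)⟩
        · obtain ⟨m, rfl⟩ := Nat.exists_eq_add_of_le' (show n ≤ k by omega)
          have hbk : b ∈ degreeLE (m + n) := fun j hj => hk j hj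
          have h1 : leadSymbol n e (m + n) b ∈ symbolSpace a n e m := by
            rw [← hM m (by omega)]
            exact ⟨b, ⟨hb, hbk⟩, rfl⟩
          obtain ⟨b', hb', hbb'⟩ := h1
          have hpos := h.pos
          -- As `n > 0`, the degree of `b'` is below `m + n` and the induction hypothesis applies.
          have h2 : b' ∈ Submodule.span (algebraGenerated ℝ a ha') (s : Set OctDiffRing) :=
            ih b' hb'.1 fun j hj => hb'.2 j (by omega)
          have h3 : r⁻¹ • (a * b') ∈
              Submodule.span (algebraGenerated ℝ a ha') (s : Set OctDiffRing) := by
            rw [← smul_mul_assoc]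
            exact Submodule.smul_mem _ (r⁻¹ • (⟨⟨a, ha'⟩, Algebra.self_mem_adjoin_singleton ℝ _⟩ :
              algebraGenerated ℝ a ha')) h2
          have h4 : b - r⁻¹ • (a * b') ∈ centralizerSubspace ℝ a ⊓ degreeLE (m + n) :=
            sub_mem ⟨hb, hbk⟩ (Submodule.smul_mem _ _
              ⟨mul_mem_centralizerSubspace ha' hb'.1, h.mul_mem_degreeLE hb'.2⟩)
          -- The symbols cancel, so the whole coefficient of `x^(m+n)` cancels and the degree drops.
          have h5 : leadSymbol n e (m + n) (b - r⁻¹ • (a * b')) = 0 := by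
            rw [map_sub, map_smul, hmul m b' hb', inv_smul_smul₀ hr, hbb', sub_self]
          have h6 := ih _ h4.1 fun j hj => by
            rcases hj.eq_or_lt with rfl | hj
            · exact h.coeff_eq_zero_of_leadSymbol ha h4.1 h4.2 h5
            · exact h4.2 j hj
          simpa using add_mem h6 h3
    by_cases hb0 : b = 0
    · exact hb0 ▸ zero_mem _
    · obtain ⟨m, -, -, hm⟩ := exists_degree_eq hb0
      exact key (m + 1) b hb fun j hj => hm j hj

end

end NonAssocOre

/-! ### The theorem -/

theorem mainTheorem5 :
    NonAssocOre.octY ∈ NonAssocOre.nucleus ℝ NonAssocOre.OctDiffRing ∧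
    NonAssocOre.IsPseudoDegree
      (NonAssocOre.OreExtension.degree : NonAssocOre.OctDiffRing → WithBot ℤ) ∧
    ∀ a : NonAssocOre.OctDiffRing, 0 < a.degree → NonAssocOre.HasRealPolyCoeffs a →
      NonAssocOre.ConditionD ℝ (NonAssocOre.OreExtension.degree) (Set.centralizer {a}) 8 ∧
      ∃ ha : a ∈ NonAssocOre.nucleus ℝ NonAssocOre.OctDiffRing,
        Module.Free (NonAssocOre.algebraGenerated ℝ a ha)
          (NonAssocOre.centralizerModule ℝ a ha) ∧
        Module.Finite (NonAssocOre.algebraGenerated ℝ a ha)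
          (NonAssocOre.centralizerModule ℝ a ha) := by
  refine ⟨NonAssocOre.octY_mem_nucleus, NonAssocOre.OreExtension.isPseudoDegree_degree rfl,
    fun a ha hreal => ?_⟩
  obtain ⟨n, e, h⟩ := NonAssocOre.exists_hasBidegree ha
  have ha' := NonAssocOre.mem_nucleus_of_hasRealPolyCoeffs hreal
  have : Module.Finite (NonAssocOre.algebraGenerated ℝ a ha')
      (NonAssocOre.centralizerModule ℝ a ha') :=
    Module.Finite.iff_fg.2 (h.fg_centralizerModule hreal ha')
  have : Nontrivial NonAssocOre.OctDiffRing := by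
    refine ⟨a, 0, ?_⟩
    rintro rfl
    exact not_lt_bot ha
  exact ⟨h.conditionD hreal, ha', NonAssocOre.free_centralizerModule a ha', inferInstance⟩
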